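/- Conventions. Operators are bounded linear operators on complex Hilbert spaces, ordered by $X\le Y$ iff $Y-X$ is positive; an operator is strictly positive if it is positive and invertible. Write $A\nabla B=\frac{A+B}{2}$ and $A\sharp B=B^{1/2}\left(B^{-1/2}AB^{-1/2}\right)^{1/2}B^{1/2}$. A continuous function $f:(0,\infty)\to(0,\infty)$ is operator log-convex if $f(A\nabla B)\le f(A)\sharp f(B)$ for all strictly positive operators $A,B$ on any Hilbert space. Let $\mathfrak A$ be a $C^*$-algebra of operators on a Hilbert space and $T$ a locally compact Hausdorff space with a bounded Radon measure $\mu$. A continuous field of strictly positive operators in $\mathfrak A$ is a norm continuous map $t\mapsto A_t$ from $T$ into $\mathfrak A$ all of whose values are strictly positive; $\nabla$ and linear combinations of fields are taken pointwise. For two such fields $\widetilde A=(A_t)_{t\in T}$, $\widetilde B=(B_t)_{t\in T}$ put $$\Theta(\widetilde A,\widetilde B)=\int_T B_t^{1/2}f\left(B_t^{-1/2}A_tB_t^{-1/2}\right)B_t^{1/2}\,d\mu(t),$$ which is said to exist if the integrand is Bochner integrable. (If $\mu=0$, then $\Theta=0$ and $0\sharp 0=0$.) Theorem. Let $f:(0,\infty)\to(0,\infty)$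 be continuous. The following are equivalent. (i) $f$ is operator log-convex. (ii) For all $\mathfrak A$, $T$, $\mu$ as above and all continuous fields $\widetilde A,\widetilde B,\widetilde C,\widetilde D$ of strictly positive operators in $\mathfrak A$ such that $\Theta(\widetilde A,\widetilde B)$, $\Theta(\widetilde A,\widetilde D)$, $\Theta(\widetilde C,\widetilde B)$ and $\Theta(\widetilde C,\widetilde D)$ exist, $\Theta(\widetilde A\nabla\widetilde C,\widetilde B\nabla\widetilde D)$ exists and $$\Theta(\widetilde A\nabla\widetilde C,\widetilde B\nabla\widetilde D)\le\left(\Theta(\widetilde A,\widetilde B)\nabla\Theta(\widetilde A,\widetilde D)\right)\sharp\left(\Theta(\widetilde C,\widetilde B)\nabla\Theta(\widetilde C,\widetilde D)\right).$$ (iii) $\Theta$ is operator log-convex in its first variable and operator convex in its second variable, that is, for all $\mathfrak A$, $T$, $\mu$ as above and all continuous fields of strictly positive operators in $\mathfrak A$: if $\Theta(\widetilde A,\widetilde B)$ and $\Theta(\widetilde C,\widetilde B)$ exist, then $\Theta(\widetilde A\nabla\widetilde C,\widetilde B)$ exists and $\Theta(\widetilde A\nabla\widetilde C,\widetilde B)\le\Theta(\widetilde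 A,\widetilde B)\sharp\Theta(\widetilde C,\widetilde B)$; and if $\Theta(\widetilde A,\widetilde B)$ and $\Theta(\widetilde A,\widetilde D)$ exist, then for every $\lambda\in[0,1]$, $\Theta(\widetilde A,\lambda\widetilde B+(1-\lambda)\widetilde D)$ exists and $\Theta(\widetilde A,\lambda\widetilde B+(1-\lambda)\widetilde D)\le\lambda\,\Theta(\widetilde A,\widetilde B)+(1-\lambda)\,\Theta(\widetilde A,\widetilde D)$. -/

import Mathlib

universe u v

open MeasureTheory

noncomputable section

namespace FDiv

section Operators

variable {H : Type u} [NormedAddCommGroup H] [InnerProductSpace ℂ H] [CompleteSpace H]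

/-- Arithmetic mean `A ∇ B = (A + B) / 2`. -/
def arithMean (A B : H →L[ℂ] H) : H →L[ℂ] H := (1 / 2 : ℝ) • (A + B)

/-- Geometric mean `A ♯ B = B^{1/2} (B^{-1/2} A B^{-1/2})^{1/2} B^{1/2}`. The powers are those of
the continuous functional calculus, so for strictly positive `A`, `B` they are the usual ones. -/
def geomMean (A B : H →L[ℂ] H) : H →L[ℂ] H :=
  B ^ (1 / 2 : ℝ) * (B ^ (-1 / 2 : ℝ) * A * B ^ (-1 / 2 : ℝ)) ^ (1 / 2 : ℝ) * B ^ (1 / 2 : ℝ)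

/-- The operator `B^{1/2} f(B^{-1/2} A B^{-1/2}) B^{1/2}`; `f` is applied through the continuous
functional calculus. -/
def perspective (f : ℝ → ℝ) (A B : H →L[ℂ] H) : H →L[ℂ] H :=
  B ^ (1 / 2 : ℝ) * cfc f (B ^ (-1 / 2 : ℝ) * A * B ^ (-1 / 2 : ℝ)) * B ^ (1 / 2 : ℝ)

/-- `(A_t)_{t ∈ T}` is a norm continuous field of strictly positive (positive and invertible)
operators in the C*-algebra `𝔄` of operators on `H`. -/
structure IsPosField {T : Type v} [TopologicalSpace T]
    (𝔄 : NonUnitalStarSubalgebra ℂ (H →L[ℂ] H)) (A : T → (H →L[ℂ] H)) : Prop where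
  continuous : Continuous A
  mem : ∀ t, A t ∈ 𝔄
  strictlyPositive : ∀ t, IsStrictlyPositive (A t)

variable {T : Type v} [MeasurableSpace T]

/-- The integral defining `Θ(A, B)` exists. -/
def DivergenceExists (f : ℝ → ℝ) (μ : Measure T) (A B : T → (H →L[ℂ] H)) : Prop :=
  Integrable (fun t => perspective f (A t) (B t)) μ

/-- The non-commutative `f`-divergence functional
`Θ(A, B) = ∫_T B_t^{1/2} f(B_t^{-1/2} A_t B_t^{-1/2}) B_t^{1/2} dμ(t)`. -/
def divergence (f : ℝ → ℝ) (μ : Measure T) (A B : T → (H →L[ℂ] H)) : H →L[ℂ] H :=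
  ∫ t, perspective f (A t) (B t) ∂μ

end Operators

/-- `f` is operator log-convex: `f(A ∇ B) ≤ f(A) ♯ f(B)` for all strictly positive operators
`A`, `B` on any complex Hilbert space. -/
def OperatorLogConvex (f : ℝ → ℝ) : Prop :=
  ∀ (H : Type u) [NormedAddCommGroup H] [InnerProductSpace ℂ H] [CompleteSpace H]
    (A B : H →L[ℂ] H), IsStrictlyPositive A → IsStrictlyPositive B →
      cfc f (arithMean A B) ≤ geomMean (cfc f A) (cfc f B)

/-- `Θ(A ∇ C, B ∇ D) ≤ (Θ(A,B) ∇ Θ(A,D)) ♯ (Θ(C,B) ∇ Θ(C,D))` for all continuous fields of strictly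
positive operators in a C*-algebra `𝔄` of Hilbert space operators, over any locally compact
Hausdorff space with a bounded Radon measure. The divergences on the right are required to exist;
that the one on the left then exists is part of the claim. -/
def DivergenceMeanInequality (f : ℝ → ℝ) : Prop :=
  ∀ (H : Type u) [NormedAddCommGroup H] [InnerProductSpace ℂ H] [CompleteSpace H]
    (𝔄 : NonUnitalStarSubalgebra ℂ (H →L[ℂ] H)), IsClosed (𝔄 : Set (H →L[ℂ] H)) →
  ∀ (T : Type v) [TopologicalSpace T] [LocallyCompactSpace T] [T2Space T]
    [MeasurableSpace T] [BorelSpace T] (μ : Measure T) [IsFiniteMeasure μ] [μ.Regular]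
    (A B C D : T → (H →L[ℂ] H)),
    IsPosField 𝔄 A → IsPosField 𝔄 B → IsPosField 𝔄 C → IsPosField 𝔄 D →
    DivergenceExists f μ A B → DivergenceExists f μ A D →
    DivergenceExists f μ C B → DivergenceExists f μ C D →
      DivergenceExists f μ (fun t => arithMean (A t) (C t)) (fun t => arithMean (B t) (D t)) ∧
      divergence f μ (fun t => arithMean (A t) (C t)) (fun t => arithMean (B t) (D t)) ≤
        geomMean (arithMean (divergence f μ A B) (divergence f μ A D))
          (arithMean (divergence f μ C B) (divergence f μ C D))

/-- `Θ` is operator log-convex in its first variable: `Θ(A ∇ C, B) ≤ Θ(A,B) ♯ Θ(C,B)`. -/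
def DivergenceLogConvexFirst (f : ℝ → ℝ) : Prop :=
  ∀ (H : Type u) [NormedAddCommGroup H] [InnerProductSpace ℂ H] [CompleteSpace H]
    (𝔄 : NonUnitalStarSubalgebra ℂ (H →L[ℂ] H)), IsClosed (𝔄 : Set (H →L[ℂ] H)) →
  ∀ (T : Type v) [TopologicalSpace T] [LocallyCompactSpace T] [T2Space T]
    [MeasurableSpace T] [BorelSpace T] (μ : Measure T) [IsFiniteMeasure μ] [μ.Regular]
    (A B C : T → (H →L[ℂ] H)),
    IsPosField 𝔄 A → IsPosField 𝔄 B → IsPosField 𝔄 C →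
    DivergenceExists f μ A B → DivergenceExists f μ C B →
      DivergenceExists f μ (fun t => arithMean (A t) (C t)) B ∧
      divergence f μ (fun t => arithMean (A t) (C t)) B ≤
        geomMean (divergence f μ A B) (divergence f μ C B)

/-- `Θ` is operator convex in its second variable:
`Θ(A, r B + (1 - r) D) ≤ r Θ(A,B) + (1 - r) Θ(A,D)` for `r ∈ [0, 1]`. -/
def DivergenceConvexSecond (f : ℝ → ℝ) : Prop :=
  ∀ (H : Type u) [NormedAddCommGroup H] [InnerProductSpace ℂ H] [CompleteSpace H]
    (𝔄 : NonUnitalStarSubalgebra ℂ (H →L[ℂ] H)), IsClosed (𝔄 : Set (H →L[ℂ] H)) →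
  ∀ (T : Type v) [TopologicalSpace T] [LocallyCompactSpace T] [T2Space T]
    [MeasurableSpace T] [BorelSpace T] (μ : Measure T) [IsFiniteMeasure μ] [μ.Regular]
    (A B D : T → (H →L[ℂ] H)),
    IsPosField 𝔄 A → IsPosField 𝔄 B → IsPosField 𝔄 D →
    DivergenceExists f μ A B → DivergenceExists f μ A D →
    ∀ r : ℝ, 0 ≤ r → r ≤ 1 →
      DivergenceExists f μ A (fun t => r • B t + (1 - r) • D t) ∧
      divergence f μ A (fun t => r • B t + (1 - r) • D t) ≤
        r • divergence f μ A B + (1 - r) • divergence f μ A D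

end FDiv

end

/-! The argument rests on the extremal description of the geometric mean: for `S` positive and `T`
strictly positive, `S ♯ T` is the largest self-adjoint `Z` making `[[S, Z], [Z, T]]` positive
(`blockNonneg_geomMean`, `BlockNonneg.le_geomMean`). This positivity is tested by expressions linear
in `(S, Z, T)`, so it survives enlarging the diagonal, congruence and integration. Hence `♯` is
monotone, compatible with congruence, and satisfies `∫ X ♯ Y ≤ (∫ X) ♯ (∫ Y)`
(`integral_geomMean_le`).

Congruence by `B^{1/2}` turns log-convexity of `f` into log-convexity of the perspective in `A`. By
the arithmetic-geometric mean inequality `f` is also operator convex, so Jensen's operator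
inequality (`cfc_star_conj_add_le`) holds and makes the perspective convex in `B`. Monotonicity of
`♯` combines the two into a pointwise joint inequality, which is then integrated. The left-hand
integrals exist because a continuous positive field below an integrable one is integrable.

Conversely, over a one-point space with second argument `1`, the functional `Θ` is just `A ↦ f(A)`.
-/

noncomputable section

namespace FDiv

/-! ### The geometric mean through positive operator matrices. -/

section GeometricMean

variable {H : Type u} [NormedAddCommGroup H] [InnerProductSpace ℂ H] [CompleteSpace H]
  {A B C D S T Z : H →L[ℂ] H}

lemma isSelfAdjoint_rpow (B : H →L[ℂ] H) (r : ℝ) : IsSelfAdjoint (B ^ r) :=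
  .of_nonneg CFC.rpow_nonneg

lemma rpow_half_mul_rpow_half (hB : 0 ≤ B) : B ^ (1 / 2 : ℝ) * B ^ (1 / 2 : ℝ) = B := by
  rw [← CFC.sqrt_eq_rpow, CFC.sqrt_mul_sqrt_self B]

lemma rpow_half_mul_rpow_neg_half (hB : IsStrictlyPositive B) :
    B ^ (1 / 2 : ℝ) * B ^ (-1 / 2 : ℝ) = 1 := by
  rw [neg_div]; exact CFC.rpow_mul_rpow_neg _ hB

lemma rpow_neg_half_mul_rpow_half (hB : IsStrictlyPositive B) :
    B ^ (-1 / 2 : ℝ) * B ^ (1 / 2 : ℝ) = 1 := by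
  rw [neg_div]; exact CFC.rpow_neg_mul_rpow _ hB

/-- Congruence by an invertible self-adjoint operator preserves strict positivity. -/
lemma isStrictlyPositive_conj {c c' : H →L[ℂ] H} (hc : IsSelfAdjoint c) (h : c * c' = 1)
    (h' : c' * c = 1) (hA : IsStrictlyPositive A) : IsStrictlyPositive (c * A * c) := by
  have hu : IsUnit c := ⟨⟨c, c', h, h'⟩, rfl⟩
  refine ((hu.mul hA.isUnit).mul hu).isStrictlyPositive ?_
  simpa using hc.conjugate_nonneg hA.nonneg

lemma isStrictlyPositive_conj_rpow_half (hA : IsStrictlyPositive A) (hB : IsStrictlyPositive B) :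
    IsStrictlyPositive (B ^ (1 / 2 : ℝ) * A * B ^ (1 / 2 : ℝ)) :=
  isStrictlyPositive_conj (isSelfAdjoint_rpow _ _) (rpow_half_mul_rpow_neg_half hB)
    (rpow_neg_half_mul_rpow_half hB) hA

lemma isStrictlyPositive_conj_rpow_neg_half (hA : IsStrictlyPositive A)
    (hB : IsStrictlyPositive B) :
    IsStrictlyPositive (B ^ (-1 / 2 : ℝ) * A * B ^ (-1 / 2 : ℝ)) :=
  isStrictlyPositive_conj (isSelfAdjoint_rpow _ _) (rpow_neg_half_mul_rpow_half hB)
    (rpow_half_mul_rpow_neg_half hB) hA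

lemma isStrictlyPositive_arithMean (hA : IsStrictlyPositive A) (hB : IsStrictlyPositive B) :
    IsStrictlyPositive (arithMean A B) :=
  (hA.add_nonneg hB.nonneg).smul (by norm_num)

lemma geomMean_nonneg : 0 ≤ geomMean A B := by
  simpa [geomMean] using (isSelfAdjoint_rpow B (1 / 2)).conjugate_nonneg CFC.rpow_nonneg

/-- Positivity of the operator matrix `[[S, Z], [Z, T]]`, tested on the columns `(1, W)`. -/
def BlockNonneg (S Z T : H →L[ℂ] H) : Prop :=
  ∀ W : H →L[ℂ] H, 0 ≤ S + star W * Z + Z * W + star W * T * W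

lemma BlockNonneg.mono {S' T' : H →L[ℂ] H} (h : BlockNonneg S Z T) (hS : S ≤ S') (hT : T ≤ T') :
    BlockNonneg S' Z T' := by
  intro W
  refine (h W).trans ?_
  gcongr
  exact star_left_conjugate_le_conjugate hT W

/-- A self-adjoint `Z` with `[[S, Z], [Z, T]]` positive lies below the geometric mean. -/
lemma BlockNonneg.le_geomMean (hT : IsStrictlyPositive T) (hZ : IsSelfAdjoint Z)
    (h : BlockNonneg S Z T) : Z ≤ geomMean S T := by
  unfold geomMean
  have e1 := rpow_half_mul_rpow_neg_half hT
  have e2 := rpow_neg_half_mul_rpow_half hT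
  have e3 := rpow_half_mul_rpow_half hT.nonneg
  have hb := isSelfAdjoint_rpow T (1 / 2)
  have hb' := isSelfAdjoint_rpow T (-1 / 2)
  generalize T ^ (1 / 2 : ℝ) = b at *
  generalize T ^ (-1 / 2 : ℝ) = c at *
  have hN : IsSelfAdjoint (c * Z * c) := by
    rw [IsSelfAdjoint, star_mul, star_mul, hb'.star_eq, hZ.star_eq, mul_assoc]
  -- The test column is `W = -T⁻¹ Z`, with `T⁻¹ = c * c`. It yields the Schur complement `S - Z T⁻¹
  -- Z ≥ 0`, which is then conjugated by `c = T^{-1/2}`.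
  have hle : c * Z * c * (c * Z * c) ≤ c * S * c := by
    have h1 := hb'.conjugate_nonneg (h (-(c * c * Z)))
    have h2 : c * (S + star (-(c * c * Z)) * Z + Z * -(c * c * Z) +
        star (-(c * c * Z)) * T * -(c * c * Z)) * c = c * S * c - c * Z * c * (c * Z * c) := by
      simp only [star_neg, star_mul, hb'.star_eq, hZ.star_eq, ← e3]
      have : Z * (c * c) * (b * b) * (c * c * Z) = Z * (c * c) * Z := by
        calc _ = Z * c * (c * b) * (b * c) * c * Z := by noncomm_ring
          _ = _ := by rw [e1, e2]; noncomm_ring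
      calc _ = c * S * c - 2 • (c * (Z * (c * c) * Z) * c)
              + c * (Z * (c * c) * (b * b) * (c * c * Z)) * c := by noncomm_ring
        _ = _ := by rw [this]; noncomm_ring
    rw [h2] at h1
    exact sub_nonneg.1 h1
  -- With `N = c * Z * c`: `N ≤ |N| = (N²)^{1/2}`, and the square root is operator monotone.
  have hsq : c * Z * c ≤ (c * S * c) ^ (1 / 2 : ℝ) := by
    calc c * Z * c ≤ CFC.abs (c * Z * c) := by
          rw [← CFC.posPart_add_negPart _ hN]
          nth_rw 1 [← CFC.posPart_sub_negPart _ hN]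
          exact (sub_le_self _ (CFC.negPart_nonneg _)).trans
            (le_add_of_nonneg_right (CFC.negPart_nonneg _))
      _ = (c * Z * c * (c * Z * c)) ^ (1 / 2 : ℝ) := by
          rw [CFC.abs, hN.star_eq, CFC.sqrt_eq_rpow]
      _ ≤ _ := CFC.rpow_le_rpow (by norm_num) hle
  calc Z = b * (c * Z * c) * b := by
        calc Z = (b * c) * Z * (c * b) := by rw [e1, e2]; simp
          _ = _ := by noncomm_ring
    _ ≤ _ := hb.conjugate_le_conjugate hsq

/-- The operator matrix `[[S, S ♯ T], [S ♯ T, T]]` is positive. -/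
lemma blockNonneg_geomMean (hS : 0 ≤ S) (hT : IsStrictlyPositive T) :
    BlockNonneg S (geomMean S T) T := by
  intro W
  have hM : 0 ≤ T ^ (-1 / 2 : ℝ) * S * T ^ (-1 / 2 : ℝ) := by
    simpa using (isSelfAdjoint_rpow T (-1 / 2)).conjugate_nonneg hS
  have e1 := rpow_half_mul_rpow_neg_half hT
  have e2 := rpow_neg_half_mul_rpow_half hT
  have e3 := rpow_half_mul_rpow_half hT.nonneg
  have e4 := rpow_half_mul_rpow_half hM
  have hb := isSelfAdjoint_rpow T (1 / 2)
  have hr := isSelfAdjoint_rpow (T ^ (-1 / 2 : ℝ) * S * T ^ (-1 / 2 : ℝ)) (1 / 2)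
  unfold geomMean
  generalize (T ^ (-1 / 2 : ℝ) * S * T ^ (-1 / 2 : ℝ)) ^ (1 / 2 : ℝ) = r at *
  generalize T ^ (1 / 2 : ℝ) = b at *
  generalize T ^ (-1 / 2 : ℝ) = c at *
  have hS' : S = b * r * (r * b) := by
    calc S = (b * c) * S * (c * b) := by rw [e1, e2]; simp
      _ = b * (c * S * c) * b := by noncomm_ring
      _ = _ := by rw [← e4]; noncomm_ring
  -- The matrix factors as a square: `S = (r b)* (r b)`, `T = b * b`, and the off-diagonal entry is
  -- `(r b)* b`.
  have : S + star W * (b * r * b) + b * r * b * W + star W * T * W =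
      star (r * b + b * W) * (r * b + b * W) := by
    rw [hS', ← e3, star_add, star_mul, star_mul, hr.star_eq, hb.star_eq]
    noncomm_ring
  rw [this]
  exact star_mul_self_nonneg _

/-- The test column `W = -1` in the positive matrix gives `S - 2 (S ♯ T) + T ≥ 0`. -/
lemma geomMean_le_arithMean (hS : 0 ≤ S) (hT : IsStrictlyPositive T) :
    geomMean S T ≤ arithMean S T := by
  have h := blockNonneg_geomMean hS hT (-1)
  have h2 : S + star (-1) * geomMean S T + geomMean S T * -1 + star (-1) * T * -1 =
      (2 : ℝ) • (arithMean S T - geomMean S T) := by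
    rw [arithMean, smul_sub, smul_smul, two_smul ℝ (geomMean S T)]
    norm_num
    abel
  rw [h2] at h
  have := smul_nonneg (by norm_num : (0 : ℝ) ≤ 1 / 2) h
  rw [smul_smul] at this
  norm_num at this
  exact this

/-- Enlarging the diagonal keeps `[[S, S ♯ T], [S ♯ T, T]]` positive, so `S ♯ T` remains a
competitor in the extremal problem for `S' ♯ T'`. -/
lemma geomMean_mono {S' T' : H →L[ℂ] H} (hS : 0 ≤ S) (hT : IsStrictlyPositive T)
    (hSS' : S ≤ S') (hTT' : T ≤ T') : geomMean S T ≤ geomMean S' T' :=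
  ((blockNonneg_geomMean hS hT).mono hSS' hTT').le_geomMean (hT.of_le hTT')
    (.of_nonneg geomMean_nonneg)

/-- Congruence by an invertible self-adjoint operator is compatible with the geometric mean. -/
lemma conj_geomMean_le {c c' : H →L[ℂ] H} (hc : IsSelfAdjoint c) (h : c * c' = 1)
    (h' : c' * c = 1) (hS : 0 ≤ S) (hT : IsStrictlyPositive T) :
    c * geomMean S T * c ≤ geomMean (c * S * c) (c * T * c) := by
  refine BlockNonneg.le_geomMean (isStrictlyPositive_conj hc h h' hT)
    (.of_nonneg (by simpa using hc.conjugate_nonneg geomMean_nonneg)) fun W => ?_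
  have hs : star c' * c = 1 := by
    have := congrArg star h
    rwa [star_mul, hc.star_eq, star_one] at this
  have hs' : star c' = c' := by
    calc star c' = star c' * (c * c') := by rw [h, mul_one]
      _ = (star c' * c) * c' := by noncomm_ring
      _ = c' := by rw [hs, one_mul]
  -- The column `c W c⁻¹` is chosen so that conjugating by `c` turns the test for `(S, T)` into the
  -- test at `W` for `(c S c, c T c)`.
  have h1 := hc.conjugate_nonneg (blockNonneg_geomMean hS hT (c * W * c'))
  have h2 : c * (S + star (c * W * c') * geomMean S T + geomMean S T * (c * W * c') +
      star (c * W * c') * T * (c * W * c')) * c =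
      c * S * c + star W * (c * geomMean S T * c) + c * geomMean S T * c * W +
        star W * (c * T * c) * W := by
    simp only [star_mul, hs', hc.star_eq]
    generalize geomMean S T = Z
    calc _ = c * S * c + (c * c') * star W * c * Z * c + c * Z * c * W * (c' * c) +
          (c * c') * star W * (c * T * c) * W * (c' * c) := by noncomm_ring
      _ = _ := by rw [h, h']; noncomm_ring
  rwa [h2] at h1

end GeometricMean

/-! ### Polynomials of intertwined operators. -/

section Algebraic

variable {H : Type u} [NormedAddCommGroup H] [InnerProductSpace ℂ H]
  {K : Type u} [NormedAddCommGroup K] [InnerProductSpace ℂ K]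

lemma arithMean_eq_convexCombination (B D : H →L[ℂ] H) :
    arithMean B D = (1 / 2 : ℝ) • B + (1 - 1 / 2 : ℝ) • D := by
  rw [arithMean, smul_add]; norm_num

lemma aeval_comp_of_intertwine {S : K →L[ℂ] K} {A : H →L[ℂ] H} {V : H →L[ℂ] K}
    (h : S ∘L V = V ∘L A) (p : Polynomial ℝ) :
    (Polynomial.aeval S p) ∘L V = V ∘L (Polynomial.aeval A p) := by
  have hx : ∀ x, S (V x) = V (A x) := fun x => congrArg (· x) h
  induction p using Polynomial.induction_on' with
  | add p q hp hq => simp [ContinuousLinearMap.add_comp, ContinuousLinearMap.comp_add, hp, hq]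
  | monomial n a =>
    have hn : ∀ x, (S ^ n) (V x) = V ((A ^ n) x) := by
      induction n with
      | zero => simp
      | succ n ih => intro x; simp [pow_succ, hx, ih]
    ext x
    simp [Polynomial.aeval_monomial, Algebra.algebraMap_eq_smul_one, hn]

end Algebraic

/-! ### Jensen's operator inequality. -/

section Jensen

variable {H : Type u} [NormedAddCommGroup H] [InnerProductSpace ℂ H] [CompleteSpace H]
  {K : Type u} [NormedAddCommGroup K] [InnerProductSpace ℂ K] [CompleteSpace K]
  {f : ℝ → ℝ}

lemma spectrum_subset_Ioi {A : H →L[ℂ] H} (hA : IsStrictlyPositive A) :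
    spectrum ℝ A ⊆ Set.Ioi 0 := fun _ hx => hA.spectrum_pos hx

lemma isStrictlyPositive_cfc (hf : ContinuousOn f (Set.Ioi 0)) (hpos : ∀ x, 0 < x → 0 < f x)
    {A : H →L[ℂ] H} (hA : IsStrictlyPositive A) : IsStrictlyPositive (cfc f A) :=
  (cfc_isStrictlyPositive_iff f A (hf.mono (spectrum_subset_Ioi hA))
    (IsSelfAdjoint.of_nonneg hA.nonneg)).2 fun _ hx => hpos _ (hA.spectrum_pos hx)

/-- The continuous functional calculus respects intertwining operators. -/
lemma cfc_comp_of_intertwine (hf : ContinuousOn f (Set.Ioi 0)) {S : K →L[ℂ] K} {A : H →L[ℂ] H}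
    (hS : IsStrictlyPositive S) (hA : IsStrictlyPositive A) {V : H →L[ℂ] K}
    (h : S ∘L V = V ∘L A) : (cfc f S) ∘L V = V ∘L (cfc f A) := by
  -- The point `1` keeps `σ` nonempty even on trivial spaces, where spectra are empty. The infimum
  -- of the compact `σ` is attained, hence positive, so `f` is continuous on the whole interval used
  -- for Weierstrass approximation.
  set σ : Set ℝ := insert 1 (spectrum ℝ S ∪ spectrum ℝ A) with hσ
  have hσc : IsCompact σ :=
    ((ContinuousFunctionalCalculus.isCompact_spectrum S).union
      (ContinuousFunctionalCalculus.isCompact_spectrum A)).insert 1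
  have hσne : σ.Nonempty := ⟨1, Set.mem_insert _ _⟩
  have hσpos : σ ⊆ Set.Ioi 0 := Set.insert_subset (by simp)
    (Set.union_subset (spectrum_subset_Ioi hS) (spectrum_subset_Ioi hA))
  have hσI : σ ⊆ Set.Icc (sInf σ) (sSup σ) := fun x hx =>
    ⟨csInf_le hσc.bddBelow hx, le_csSup hσc.bddAbove hx⟩
  have hf' : ContinuousOn f (Set.Icc (sInf σ) (sSup σ)) :=
    hf.mono fun x hx => lt_of_lt_of_le (hσpos (hσc.sInf_mem hσne)) hx.1
  have key : ∀ {E : Type u} [NormedAddCommGroup E] [InnerProductSpace ℂ E] [CompleteSpace E]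
      (B : E →L[ℂ] E), IsStrictlyPositive B → spectrum ℝ B ⊆ σ → ∀ ε > 0, ∀ p : Polynomial ℝ,
      (∀ x ∈ Set.Icc (sInf σ) (sSup σ), |Polynomial.eval x p - f x| < ε) →
      ‖Polynomial.aeval B p - cfc f B‖ ≤ ε := by
    intro E _ _ _ B hB hBσ ε hε p hp
    have hsa : IsSelfAdjoint B := .of_nonneg hB.nonneg
    rw [← cfc_polynomial p B hsa, ← cfc_sub _ _ B p.continuous.continuousOn
      (hf.mono (spectrum_subset_Ioi hB))]
    exact norm_cfc_le hε.le fun x hx => (hp x (hσI (hBσ hx))).le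
  rw [← sub_eq_zero, ← norm_le_zero_iff]
  refine le_of_forall_pos_le_add fun ε hε => ?_
  obtain ⟨p, hp⟩ := exists_polynomial_near_of_continuousOn _ _ f hf' (ε / (2 * (‖V‖ + 1)))
    (by positivity)
  have h1 := key S hS (fun x hx => Or.inr (Or.inl hx)) _ (by positivity) p hp
  have h2 := key A hA (fun x hx => Or.inr (Or.inr hx)) _ (by positivity) p hp
  have h3 : cfc f S ∘L V - V ∘L cfc f A =
      V ∘L (Polynomial.aeval A p - cfc f A) - (Polynomial.aeval S p - cfc f S) ∘L V := by
    rw [ContinuousLinearMap.comp_sub, ContinuousLinearMap.sub_comp, aeval_comp_of_intertwine h p]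
    abel
  have hV := norm_nonneg V
  rw [h3, zero_add]
  calc _ ≤ ‖V‖ * (ε / (2 * (‖V‖ + 1))) + ε / (2 * (‖V‖ + 1)) * ‖V‖ :=
        (norm_sub_le _ _).trans (add_le_add
          ((ContinuousLinearMap.opNorm_comp_le _ _).trans (by gcongr))
          ((ContinuousLinearMap.opNorm_comp_le _ _).trans (by gcongr)))
    _ = ε * (‖V‖ / (‖V‖ + 1)) := by field_simp; ring
    _ ≤ ε * 1 := by gcongr; rw [div_le_one (by positivity)]; linarith
    _ = ε := mul_one _

open ContinuousLinearMap in
/-- Jensen's operator inequality for a compression by an isometry. -/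
lemma cfc_adjoint_conj_le (hf : ContinuousOn f (Set.Ioi 0)) (hpos : ∀ x, 0 < x → 0 < f x)
    (hlog : OperatorLogConvex.{u} f) {S : K →L[ℂ] K} (hS : IsStrictlyPositive S)
    {V : H →L[ℂ] K} (hV : adjoint V ∘L V = ContinuousLinearMap.id ℂ H)
    (hW : IsStrictlyPositive (adjoint V ∘L S ∘L V)) :
    cfc f (adjoint V ∘L S ∘L V) ≤ adjoint V ∘L (cfc f S) ∘L V := by
  set P : K →L[ℂ] K := V ∘L adjoint V with hP
  have hPsa : star P = P := by
    rw [star_eq_adjoint, hP, adjoint_comp, adjoint_adjoint]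
  have hPP : P * P = P := by
    calc P * P = V ∘L (adjoint V ∘L V) ∘L adjoint V := rfl
      _ = P := by rw [hV]; rfl
  -- The reflection in the range of `V`. Averaging `S` and `U S U` removes the blocks off the
  -- diagonal for `P`, so the average leaves the range of `V` invariant and acts there as the
  -- compression of `S`.
  set U : K →L[ℂ] K := 2 * P - 1 with hU
  have hUU : U * U = 1 := by
    calc U * U = 4 * (P * P) - 4 * P + 1 := by rw [hU]; noncomm_ring
      _ = 1 := by rw [hPP]; noncomm_ring
  have hUsa : IsSelfAdjoint U := by
    rw [IsSelfAdjoint, hU, star_sub, star_mul, hPsa, star_one, star_ofNat]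
    noncomm_ring
  have hPV : P ∘L V = V := by rw [hP, comp_assoc, hV]; rfl
  have hUV : U ∘L V = V := by
    have : U ∘L V = (2 : ℂ) • (P ∘L V) - V := by
      ext x; simp [hU, two_smul, two_mul]
    rw [this, hPV, two_smul]; abel
  have hVU : adjoint V ∘L U = adjoint V := by
    have := congrArg adjoint hUV
    rwa [adjoint_comp, ← star_eq_adjoint U, hUsa.star_eq] at this
  have hS' : IsStrictlyPositive (U * S * U) := isStrictlyPositive_conj hUsa hUU hUU hS
  have hR := isStrictlyPositive_arithMean hS hS'
  have hRV : arithMean S (U * S * U) ∘L V = V ∘L (adjoint V ∘L S ∘L V) := by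
    have h1 : (U * S * U) ∘L V = U ∘L S ∘L V := by
      change U ∘L S ∘L (U ∘L V) = _
      rw [hUV]
    have h2 : arithMean S (U * S * U) ∘L V = (1 / 2 : ℝ) • (S ∘L V + U ∘L S ∘L V) := by
      rw [← h1]; rfl
    have h3 : U ∘L S ∘L V = (2 : ℝ) • (P ∘L S ∘L V) - S ∘L V := by
      ext x; simp [hU, two_smul, two_mul]
    rw [h2, h3, add_sub_cancel, smul_smul]
    norm_num
    rfl
  have hle := hlog K S (U * S * U) hS hS'
  have hfS := isStrictlyPositive_cfc hf hpos hS
  have hfS' := isStrictlyPositive_cfc hf hpos hS'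
  -- From here on only operator convexity of `f` matters.
  have hle' := hle.trans (geomMean_le_arithMean hfS.nonneg hfS')
  have hcU : cfc f (U * S * U) * U = U * cfc f S :=
    cfc_comp_of_intertwine hf hS' hS (V := U) (by
      change U * S * U * U = U * S
      rw [mul_assoc, hUU, mul_one])
  have hcU' : cfc f (U * S * U) = U * cfc f S * U := by
    rw [← hcU, mul_assoc (cfc f _), hUU, mul_one]
  have hcR := cfc_comp_of_intertwine hf hR hW hRV
  have h4 : adjoint V ∘L cfc f (arithMean S (U * S * U)) ∘L V = cfc f (adjoint V ∘L S ∘L V) := by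
    rw [hcR, ← comp_assoc, hV]; rfl
  -- As `U` fixes the range of `V`, both `f(S)` and `U f(S) U` have the same compression.
  have h5 : adjoint V ∘L arithMean (cfc f S) (cfc f (U * S * U)) ∘L V =
      adjoint V ∘L cfc f S ∘L V := by
    have h6 : adjoint V ∘L (U * cfc f S * U) ∘L V = adjoint V ∘L cfc f S ∘L V := by
      change (adjoint V ∘L U) ∘L cfc f S ∘L (U ∘L V) = _
      rw [hUV, hVU]
    rw [hcU']
    have h7 : adjoint V ∘L arithMean (cfc f S) (U * cfc f S * U) ∘L V =
        (1 / 2 : ℝ) • (adjoint V ∘L cfc f S ∘L V + adjoint V ∘L (U * cfc f S * U) ∘L V) := by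
      ext x; simp [arithMean]
    rw [h7, h6, ← two_smul ℝ, smul_smul]
    norm_num
  rw [← h4, ← h5]
  rw [ContinuousLinearMap.le_def] at hle' ⊢
  have := hle'.adjoint_conj V
  rwa [sub_comp, comp_sub] at this

open ContinuousLinearMap in
/-- Jensen's operator inequality for the operator convex combination `X* A X + Y* B Y`. -/
lemma cfc_star_conj_add_le (hf : ContinuousOn f (Set.Ioi 0)) (hpos : ∀ x, 0 < x → 0 < f x)
    (hlog : OperatorLogConvex.{u} f) {A B X Y : H →L[ℂ] H} (hA : IsStrictlyPositive A)
    (hB : IsStrictlyPositive B) (hXY : star X * X + star Y * Y = 1)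
    (hW : IsStrictlyPositive (star X * A * X + star Y * B * Y)) :
    cfc f (star X * A * X + star Y * B * Y) ≤
      star X * cfc f A * X + star Y * cfc f B * Y := by
  -- The compression inequality is applied on `H ⊕ H` to `diag(A, B)` and the isometry `x ↦ (X x, Y
  -- x)`. The ℓ² product is a Hilbert space in the same universe as `H`.
  let p₁ : WithLp 2 (H × H) →L[ℂ] H := WithLp.fstL 2 ℂ H H
  let p₂ : WithLp 2 (H × H) →L[ℂ] H := WithLp.sndL 2 ℂ H H
  let i₁ : H →L[ℂ] WithLp 2 (H × H) :=
    (WithLp.prodContinuousLinearEquiv 2 ℂ H H).symm.toContinuousLinearMap ∘L inl ℂ H H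
  let i₂ : H →L[ℂ] WithLp 2 (H × H) :=
    (WithLp.prodContinuousLinearEquiv 2 ℂ H H).symm.toContinuousLinearMap ∘L inr ℂ H H
  have ha₁ : adjoint i₁ = p₁ := by
    symm
    rw [eq_adjoint_iff]
    intro x y
    simp [i₁, p₁, WithLp.prod_inner_apply]
  have ha₂ : adjoint i₂ = p₂ := by
    symm
    rw [eq_adjoint_iff]
    intro x y
    simp [i₂, p₂, WithLp.prod_inner_apply]
  have h₁₁ : ∀ x, p₁ (i₁ x) = x := fun x => rfl
  have h₂₂ : ∀ x, p₂ (i₂ x) = x := fun x => rfl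
  have h₁₂ : ∀ x, p₁ (i₂ x) = 0 := fun x => rfl
  have h₂₁ : ∀ x, p₂ (i₁ x) = 0 := fun x => rfl
  have hsum : ∀ z, i₁ (p₁ z) + i₂ (p₂ z) = z := fun z => by
    apply (WithLp.prodContinuousLinearEquiv 2 ℂ H H).injective
    ext <;> simp [i₁, i₂, p₁, p₂]
  let diag (A B : H →L[ℂ] H) : WithLp 2 (H × H) →L[ℂ] WithLp 2 (H × H) :=
    i₁ ∘L A ∘L p₁ + i₂ ∘L B ∘L p₂
  have hmul : ∀ A B A' B', diag A B * diag A' B' = diag (A * A') (B * B') := by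
    intro A B A' B'
    ext1 z
    simp [diag, h₁₁, h₂₂, h₁₂, h₂₁]
  have hone : diag 1 1 = 1 := by
    ext1 z
    simpa [diag] using hsum z
  have hS : IsStrictlyPositive (diag A B) := by
    refine IsUnit.isStrictlyPositive ?_ ?_
    · obtain ⟨a, ha⟩ := hA.isUnit
      obtain ⟨b, hb⟩ := hB.isUnit
      refine ⟨⟨diag A B, diag ↑a⁻¹ ↑b⁻¹, ?_, ?_⟩, rfl⟩ <;> rw [hmul, ← ha, ← hb] <;> simp [hone]
    · rw [nonneg_iff_isPositive]
      refine IsPositive.add ?_ ?_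
      · have := ((nonneg_iff_isPositive A).1 hA.nonneg).adjoint_conj p₁
        rwa [← ha₁, adjoint_adjoint, ha₁] at this
      · have := ((nonneg_iff_isPositive B).1 hB.nonneg).adjoint_conj p₂
        rwa [← ha₂, adjoint_adjoint, ha₂] at this
  let V : H →L[ℂ] WithLp 2 (H × H) := i₁ ∘L X + i₂ ∘L Y
  have hVa : adjoint V = star X ∘L p₁ + star Y ∘L p₂ := by
    rw [map_add, adjoint_comp, adjoint_comp, ha₁, ha₂]; rfl
  have hV : adjoint V ∘L V = ContinuousLinearMap.id ℂ H := by
    change _ = (1 : H →L[ℂ] H)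
    rw [hVa, ← hXY]
    ext1 x
    simp [V, h₁₁, h₂₂, h₁₂, h₂₁]
  have hVS : ∀ S₁ S₂ : H →L[ℂ] H, ∀ S, S ∘L i₁ = i₁ ∘L S₁ → S ∘L i₂ = i₂ ∘L S₂ →
      adjoint V ∘L S ∘L V = star X * S₁ * X + star Y * S₂ * Y := by
    intro S₁ S₂ S e₁ e₂
    have e₁' : ∀ x, S (i₁ x) = i₁ (S₁ x) := fun x => congrArg (· x) e₁
    have e₂' : ∀ x, S (i₂ x) = i₂ (S₂ x) := fun x => congrArg (· x) e₂
    rw [hVa]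
    ext1 x
    simp [V, e₁', e₂', h₁₁, h₂₂, h₁₂, h₂₁]
  have e₁ : diag A B ∘L i₁ = i₁ ∘L A := by
    ext1 x; simp [diag, h₁₁, h₂₁]
  have e₂ : diag A B ∘L i₂ = i₂ ∘L B := by
    ext1 x; simp [diag, h₂₂, h₁₂]
  have hL := hVS A B _ e₁ e₂
  have hR := hVS _ _ _ (cfc_comp_of_intertwine hf hS hA e₁) (cfc_comp_of_intertwine hf hS hB e₂)
  have := cfc_adjoint_conj_le hf hpos hlog hS hV (by rwa [hL])
  rwa [hL, hR] at this

end Jensen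

/-! ### Convexity properties of the perspective. -/

section Perspective

variable {H : Type u} [NormedAddCommGroup H] [InnerProductSpace ℂ H] [CompleteSpace H]
  {f : ℝ → ℝ} {A B C D : H →L[ℂ] H}

lemma isStrictlyPositive_perspective (hf : ContinuousOn f (Set.Ioi 0))
    (hpos : ∀ x, 0 < x → 0 < f x) (hA : IsStrictlyPositive A) (hB : IsStrictlyPositive B) :
    IsStrictlyPositive (perspective f A B) :=
  isStrictlyPositive_conj_rpow_half
    (isStrictlyPositive_cfc hf hpos (isStrictlyPositive_conj_rpow_neg_half hA hB)) hB

lemma perspective_one_right (f : ℝ → ℝ) (A : H →L[ℂ] H) : perspective f A 1 = cfc f A := by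
  simp [perspective]

/-- The perspective of an operator log-convex function is log-convex in its first variable. -/
lemma perspective_arithMean_left_le (hf : ContinuousOn f (Set.Ioi 0))
    (hpos : ∀ x, 0 < x → 0 < f x) (hlog : OperatorLogConvex.{u} f)
    (hA : IsStrictlyPositive A) (hC : IsStrictlyPositive C) (hB : IsStrictlyPositive B) :
    perspective f (arithMean A C) B ≤ geomMean (perspective f A B) (perspective f C B) := by
  have hA' := isStrictlyPositive_conj_rpow_neg_half hA hB
  have hC' := isStrictlyPositive_conj_rpow_neg_half hC hB
  have h := hlog H _ _ hA' hC'
  have hm : arithMean (B ^ (-1 / 2 : ℝ) * A * B ^ (-1 / 2 : ℝ))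
      (B ^ (-1 / 2 : ℝ) * C * B ^ (-1 / 2 : ℝ)) =
      B ^ (-1 / 2 : ℝ) * arithMean A C * B ^ (-1 / 2 : ℝ) := by
    simp only [arithMean, mul_smul_comm, smul_mul_assoc, mul_add, add_mul]
  rw [hm] at h
  have hb := isSelfAdjoint_rpow B (1 / 2)
  exact (hb.conjugate_le_conjugate h).trans (conj_geomMean_le hb (rpow_half_mul_rpow_neg_half hB)
    (rpow_neg_half_mul_rpow_half hB) (isStrictlyPositive_cfc hf hpos hA').nonneg
    (isStrictlyPositive_cfc hf hpos hC'))

lemma isStrictlyPositive_convexCombination {r : ℝ} (hr : 0 ≤ r) (hr' : r ≤ 1)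
    (hB : IsStrictlyPositive B) (hD : IsStrictlyPositive D) :
    IsStrictlyPositive (r • B + (1 - r) • D) := by
  rcases hr.eq_or_lt with rfl | h
  · simpa using hD
  · exact (hB.smul h).add_nonneg (smul_nonneg (sub_nonneg.2 hr') hD.nonneg)

/-- The perspective of an operator log-convex function is convex in its second variable. -/
lemma perspective_convexCombination_right_le (hf : ContinuousOn f (Set.Ioi 0))
    (hpos : ∀ x, 0 < x → 0 < f x) (hlog : OperatorLogConvex.{u} f)
    (hA : IsStrictlyPositive A) (hB : IsStrictlyPositive B) (hD : IsStrictlyPositive D)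
    {r : ℝ} (hr : 0 ≤ r) (hr' : r ≤ 1) :
    perspective f A (r • B + (1 - r) • D) ≤
      r • perspective f A B + (1 - r) • perspective f A D := by
  have hE := isStrictlyPositive_convexCombination hr hr' hB hD
  have hEA := isStrictlyPositive_conj_rpow_neg_half hA hE
  have hBA := isStrictlyPositive_conj_rpow_neg_half hA hB
  have hDA := isStrictlyPositive_conj_rpow_neg_half hA hD
  set E := r • B + (1 - r) • D with hEdef
  have e1 := rpow_half_mul_rpow_neg_half hE
  have e2 := rpow_neg_half_mul_rpow_half hE
  have e3 := rpow_half_mul_rpow_half hE.nonneg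
  have he := isSelfAdjoint_rpow E (1 / 2)
  have he' := isSelfAdjoint_rpow E (-1 / 2)
  unfold perspective
  generalize E ^ (1 / 2 : ℝ) = e at *
  generalize E ^ (-1 / 2 : ℝ) = e' at *
  -- Jensen will be used with `X = √r B^{1/2} E^{-1/2}` and `Y = √(1-r) D^{1/2} E^{-1/2}`. Then `X*
  -- X + Y* Y = E^{-1/2} E E^{-1/2} = 1`, and the operator combination of the two arguments of `f`
  -- collapses to `E^{-1/2} A E^{-1/2}`.
  have hconj : ∀ {B : H →L[ℂ] H} (_ : IsStrictlyPositive B) {s : ℝ} (_ : 0 ≤ s)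
      (M : H →L[ℂ] H),
      star (√s • (B ^ (1 / 2 : ℝ) * e')) * M * (√s • (B ^ (1 / 2 : ℝ) * e')) =
        s • (e' * (B ^ (1 / 2 : ℝ) * M * B ^ (1 / 2 : ℝ)) * e') := by
    intro B _ s hs M
    rw [star_smul, star_mul, he'.star_eq, (isSelfAdjoint_rpow B _).star_eq, star_trivial,
      smul_mul_assoc, smul_mul_assoc, mul_smul_comm, smul_smul, Real.mul_self_sqrt hs]
    simp only [mul_assoc]
  have hcancel : ∀ {B : H →L[ℂ] H} (_ : IsStrictlyPositive B),
      B ^ (1 / 2 : ℝ) * (B ^ (-1 / 2 : ℝ) * A * B ^ (-1 / 2 : ℝ)) * B ^ (1 / 2 : ℝ) = A := by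
    intro B hB
    have b1 := rpow_half_mul_rpow_neg_half hB
    have b2 := rpow_neg_half_mul_rpow_half hB
    generalize B ^ (1 / 2 : ℝ) = b at *
    generalize B ^ (-1 / 2 : ℝ) = b' at *
    calc _ = (b * b') * A * (b' * b) := by noncomm_ring
      _ = A := by rw [b1, b2]; simp
  have hs : 0 ≤ 1 - r := sub_nonneg.2 hr'
  have hXA : star (√r • (B ^ (1 / 2 : ℝ) * e')) * (B ^ (-1 / 2 : ℝ) * A * B ^ (-1 / 2 : ℝ)) *
        (√r • (B ^ (1 / 2 : ℝ) * e')) +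
      star (√(1 - r) • (D ^ (1 / 2 : ℝ) * e')) * (D ^ (-1 / 2 : ℝ) * A * D ^ (-1 / 2 : ℝ)) *
        (√(1 - r) • (D ^ (1 / 2 : ℝ) * e')) = e' * A * e' := by
    rw [hconj hB hr, hconj hD hs, hcancel hB, hcancel hD, ← add_smul]
    simp
  have hXY : star (√r • (B ^ (1 / 2 : ℝ) * e')) * (√r • (B ^ (1 / 2 : ℝ) * e')) +
      star (√(1 - r) • (D ^ (1 / 2 : ℝ) * e')) * (√(1 - r) • (D ^ (1 / 2 : ℝ) * e')) = 1 := by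
    have hB1 := hconj hB hr 1
    have hD1 := hconj hD hs 1
    rw [mul_one, mul_one, rpow_half_mul_rpow_half hB.nonneg] at hB1
    rw [mul_one, mul_one, rpow_half_mul_rpow_half hD.nonneg] at hD1
    calc _ = e' * E * e' := by
          rw [hB1, hD1, hEdef, mul_add, add_mul, mul_smul_comm, mul_smul_comm, smul_mul_assoc,
            smul_mul_assoc]
      _ = (e' * e) * (e * e') := by rw [← e3]; noncomm_ring
      _ = 1 := by rw [e1, e2, one_mul]
  have hJ := cfc_star_conj_add_le hf hpos hlog hBA hDA hXY (by rw [hXA]; exact hEA)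
  rw [hXA, hconj hB hr, hconj hD hs] at hJ
  refine (he.conjugate_le_conjugate hJ).trans_eq ?_
  have hlast : ∀ M : H →L[ℂ] H, e * (e' * M * e') * e = M := by
    intro M
    calc _ = (e * e') * M * (e' * e) := by noncomm_ring
      _ = M := by rw [e1, e2]; simp
  simp only [mul_add, add_mul, mul_smul_comm, smul_mul_assoc, hlast]

/-- The joint inequality for the perspective of an operator log-convex function. -/
lemma perspective_arithMean_arithMean_le (hf : ContinuousOn f (Set.Ioi 0))
    (hpos : ∀ x, 0 < x → 0 < f x) (hlog : OperatorLogConvex.{u} f)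
    (hA : IsStrictlyPositive A) (hB : IsStrictlyPositive B) (hC : IsStrictlyPositive C)
    (hD : IsStrictlyPositive D) :
    perspective f (arithMean A C) (arithMean B D) ≤
      geomMean (arithMean (perspective f A B) (perspective f A D))
        (arithMean (perspective f C B) (perspective f C D)) := by
  have hE := isStrictlyPositive_arithMean hB hD
  have hconv : ∀ {A : H →L[ℂ] H}, IsStrictlyPositive A → perspective f A (arithMean B D) ≤
      arithMean (perspective f A B) (perspective f A D) := fun hA => by
    simp only [arithMean_eq_convexCombination]
    exact perspective_convexCombination_right_le hf hpos hlog hA hB hD (by norm_num) (by norm_num)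
  -- Log-convexity in the first variable at the fixed second argument `B ∇ D`, then convexity in the
  -- second variable inside each argument of the monotone `♯`.
  exact (perspective_arithMean_left_le hf hpos hlog hA hC hE).trans
    (geomMean_mono (isStrictlyPositive_perspective hf hpos hA hE).nonneg
      (isStrictlyPositive_perspective hf hpos hC hE) (hconv hA) (hconv hC))

end Perspective

/-! ### Measurability and integration of operator fields. -/

/-- A continuous map into a metrizable space is almost everywhere strongly measurable with respect
to a finite regular measure: the measure is carried by a σ-compact set. -/
lemma aestronglyMeasurable_of_continuous_of_regular {T E : Type*} [TopologicalSpace T] [T2Space T]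
    [MeasurableSpace T] [BorelSpace T] (μ : Measure T) [IsFiniteMeasure μ] [μ.Regular]
    [TopologicalSpace E] [TopologicalSpace.PseudoMetrizableSpace E] {X : T → E}
    (hX : Continuous X) : AEStronglyMeasurable X μ := by
  have hε : ∀ n : ℕ, ((n : ENNReal) + 1)⁻¹ ≠ 0 := fun n =>
    ENNReal.inv_ne_zero.2 (by finiteness)
  -- Inner regularity of the whole space: the complement of the compact `K n` has measure at most `1
  -- / (n + 1)`.
  choose K _ hKc hK using fun n =>
    MeasurableSet.univ.exists_isCompact_lt_add (measure_ne_top μ Set.univ) (hε n)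
  have hKm : ∀ n, MeasurableSet (K n) := fun n => (hKc n).isClosed.measurableSet
  have hnull : μ (⋃ n, K n)ᶜ = 0 := by
    refine le_antisymm (ENNReal.le_of_forall_pos_le_add fun ε hε0 _ => ?_) bot_le
    obtain ⟨n, hn⟩ := ENNReal.exists_inv_nat_lt (ENNReal.coe_ne_zero.2 hε0.ne')
    rw [zero_add]
    calc μ (⋃ n, K n)ᶜ ≤ μ (K n)ᶜ :=
          measure_mono (Set.compl_subset_compl.2 (Set.subset_iUnion K n))
      _ = μ Set.univ - μ (K n) := measure_compl (hKm n) (measure_ne_top _ _)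
      _ ≤ ((n : ENNReal) + 1)⁻¹ := tsub_le_iff_left.2 (hK n).le
      _ ≤ (n : ENNReal)⁻¹ := ENNReal.inv_le_inv.2 le_self_add
      _ ≤ ε := hn.le
  have h : AEStronglyMeasurable X (μ.restrict (⋃ n, K n)) :=
    AEStronglyMeasurable.iUnion fun n =>
      hX.continuousOn.aestronglyMeasurable_of_isCompact (hKc n) (hKm n)
  rwa [Measure.restrict_congr_set (ae_eq_univ.2 hnull), Measure.restrict_univ] at h

section ArithmeticMean

variable {H : Type u} [NormedAddCommGroup H] [InnerProductSpace ℂ H] {T : Type v}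
  {X Y : T → (H →L[ℂ] H)}

lemma arithMean_self (A : H →L[ℂ] H) : arithMean A A = A := by
  rw [arithMean, ← two_smul ℝ, smul_smul]; norm_num

lemma continuous_arithMean [TopologicalSpace T] (hX : Continuous X) (hY : Continuous Y) :
    Continuous fun t => arithMean (X t) (Y t) := by
  simp only [arithMean]
  fun_prop

variable [MeasurableSpace T] {μ : Measure T}

lemma integrable_arithMean (hX : Integrable X μ) (hY : Integrable Y μ) :
    Integrable (fun t => arithMean (X t) (Y t)) μ := by
  simp only [arithMean]
  fun_prop

lemma integral_arithMean (hX : Integrable X μ) (hY : Integrable Y μ) :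
    ∫ t, arithMean (X t) (Y t) ∂μ = arithMean (∫ t, X t ∂μ) (∫ t, Y t ∂μ) := by
  simp only [arithMean]
  rw [integral_smul, integral_add hX hY]

end ArithmeticMean

section Fields

variable {H : Type u} [NormedAddCommGroup H] [InnerProductSpace ℂ H] [CompleteSpace H]
  {T : Type v} [TopologicalSpace T] {f : ℝ → ℝ} {A B C D X Y : T → (H →L[ℂ] H)}

lemma continuous_cfc_of_isStrictlyPositive (hf : ContinuousOn f (Set.Ioi 0)) (hA : Continuous A)
    (hA' : ∀ t, IsStrictlyPositive (A t)) : Continuous fun t => cfc f (A t) :=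
  Continuous.cfc_of_mem_nhdsSet (s := Set.Ioi 0) f
    (isOpen_Ioi.mem_nhdsSet.2 (Set.iUnion_subset fun t => spectrum_subset_Ioi (hA' t))) hA
    (fun t => .of_nonneg (hA' t).nonneg) hf

lemma continuousOn_rpow_const (r : ℝ) : ContinuousOn (fun x : ℝ => x ^ r) (Set.Ioi 0) :=
  fun x hx => (Real.continuousAt_rpow_const x r (Or.inl (ne_of_gt hx))).continuousWithinAt

lemma continuous_rpow_of_isStrictlyPositive (r : ℝ) (hA : Continuous A)
    (hA' : ∀ t, IsStrictlyPositive (A t)) : Continuous fun t => A t ^ r := by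
  have h := continuous_cfc_of_isStrictlyPositive (continuousOn_rpow_const r) hA hA'
  exact h.congr fun t => (CFC.rpow_eq_cfc_real (hA' t).nonneg).symm

lemma continuous_perspective (hf : ContinuousOn f (Set.Ioi 0)) (hA : Continuous A)
    (hB : Continuous B) (hA' : ∀ t, IsStrictlyPositive (A t))
    (hB' : ∀ t, IsStrictlyPositive (B t)) : Continuous fun t => perspective f (A t) (B t) := by
  have h1 := continuous_rpow_of_isStrictlyPositive (1 / 2) hB hB'
  have h2 := continuous_rpow_of_isStrictlyPositive (-1 / 2) hB hB'
  exact (h1.mul (continuous_cfc_of_isStrictlyPositive hf ((h2.mul hA).mul h2)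
    fun t => isStrictlyPositive_conj_rpow_neg_half (hA' t) (hB' t))).mul h1

/-- The geometric mean is the perspective of `x ↦ x^{1/2}`. -/
lemma continuous_geomMean (hA : Continuous A) (hB : Continuous B)
    (hA' : ∀ t, IsStrictlyPositive (A t)) (hB' : ∀ t, IsStrictlyPositive (B t)) :
    Continuous fun t => geomMean (A t) (B t) := by
  refine (continuous_perspective (continuousOn_rpow_const (1 / 2)) hA hB hA' hB').congr fun t => ?_
  rw [perspective, geomMean,
    CFC.rpow_eq_cfc_real (isStrictlyPositive_conj_rpow_neg_half (hA' t) (hB' t)).nonneg]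

/-- A strictly positive operator `X` dominates `(‖X⁻¹‖ + 1)⁻¹`. -/
lemma inv_norm_inverse_smul_one_le {X : H →L[ℂ] H} (hX : IsStrictlyPositive X) :
    (‖Ring.inverse X‖ + 1)⁻¹ • (1 : H →L[ℂ] H) ≤ X := by
  -- The added `1` keeps the constant nonzero on the trivial space, where the norm vanishes; it also
  -- makes the lower bound at most `1`, hence integrable for a finite measure.
  have hk : (‖Ring.inverse X‖ + 1) ≠ 0 := by positivity
  let b : (H →L[ℂ] H)ˣ := ⟨(‖Ring.inverse X‖ + 1) • 1, (‖Ring.inverse X‖ + 1)⁻¹ • 1,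
    by rw [smul_mul_smul_comm, mul_inv_cancel₀ hk]; simp,
    by rw [smul_mul_smul_comm, inv_mul_cancel₀ hk]; simp⟩
  have hI := hX.ringInverse
  obtain ⟨a, ha⟩ := hX.isUnit
  have hinv : Ring.inverse X = ↑a⁻¹ := by rw [← ha, Ring.inverse_unit]
  have h1 : Ring.inverse X ≤ (‖Ring.inverse X‖ + 1) • (1 : H →L[ℂ] H) := by
    have := IsSelfAdjoint.le_algebraMap_norm_self (IsSelfAdjoint.of_nonneg hI.nonneg)
    rw [Algebra.algebraMap_eq_smul_one] at this
    rw [add_smul, one_smul]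
    exact this.trans (le_add_of_nonneg_right zero_le_one)
  have h2 : (↑a⁻¹ : H →L[ℂ] H) ≤ ↑b := by rw [← hinv]; exact h1
  have h3 := CStarAlgebra.inv_le_inv (a := a⁻¹) (b := b) (by rw [← hinv]; exact hI.nonneg) h2
  rw [inv_inv, ha] at h3
  exact h3

variable [MeasurableSpace T] [BorelSpace T] {μ : Measure T} [IsFiniteMeasure μ]

/-- The values need not have a common positive lower bound, so a continuous scalar minorant `c t • 1
≤ X t` with `0 < c ≤ 1` is integrated; `μ ≠ 0` makes `∫ c` positive. -/
lemma isStrictlyPositive_integral (hμ : μ ≠ 0) (hX : Continuous X)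
    (hX' : ∀ t, IsStrictlyPositive (X t)) (hi : Integrable X μ) :
    IsStrictlyPositive (∫ t, X t ∂μ) := by
  set c : T → ℝ := fun t => (‖Ring.inverse (X t)‖ + 1)⁻¹ with hc
  have hcpos : ∀ t, 0 < c t := fun t => by positivity
  have hinv : Continuous fun t => Ring.inverse (X t) := continuous_iff_continuousAt.2 fun t => by
    obtain ⟨a, ha⟩ := (hX' t).isUnit
    have h := NormedRing.inverse_continuousAt a
    rw [ha] at h
    exact h.comp hX.continuousAt
  have hcc : Continuous c := (hinv.norm.add continuous_const).inv₀ fun t =>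
    (add_pos_of_nonneg_of_pos (norm_nonneg _) one_pos).ne'
  have hci : Integrable c μ := by
    refine (integrable_const (1 : ℝ)).mono' hcc.aestronglyMeasurable (ae_of_all _ fun t => ?_)
    rw [Real.norm_of_nonneg (hcpos t).le]
    exact inv_le_one_of_one_le₀ (le_add_of_nonneg_left (norm_nonneg _))
  have hpos : 0 < ∫ t, c t ∂μ := by
    rw [integral_pos_iff_support_of_nonneg (fun t => (hcpos t).le) hci]
    have : Function.support c = Set.univ := Set.eq_univ_of_forall fun t => (hcpos t).ne'
    rw [this]
    exact pos_iff_ne_zero.2 (by simpa using hμ)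
  have hle : (∫ t, c t ∂μ) • (1 : H →L[ℂ] H) ≤ ∫ t, X t ∂μ := by
    rw [← integral_smul_const]
    exact integral_mono (hci.smul_const _) hi fun t => inv_norm_inverse_smul_one_le (hX' t)
  exact (isStrictlyPositive_one.smul hpos).of_le hle

variable [T2Space T] [μ.Regular]

/-- For `0 ≤ X ≤ Y` the norms are ordered too, so domination gives integrability; measurability
comes from regularity of `μ`. -/
lemma integrable_of_nonneg_of_le (hX : Continuous X) (hX0 : ∀ t, 0 ≤ X t)
    (hXY : ∀ t, X t ≤ Y t) (hY : Integrable Y μ) : Integrable X μ :=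
  hY.mono (aestronglyMeasurable_of_continuous_of_regular μ hX)
    (ae_of_all _ fun t => CStarAlgebra.norm_le_norm_of_nonneg_of_le (hX0 t) (hXY t))

lemma integrable_geomMean (hX : Continuous X) (hY : Continuous Y)
    (hX' : ∀ t, IsStrictlyPositive (X t)) (hY' : ∀ t, IsStrictlyPositive (Y t))
    (hXi : Integrable X μ) (hYi : Integrable Y μ) :
    Integrable (fun t => geomMean (X t) (Y t)) μ :=
  integrable_of_nonneg_of_le (continuous_geomMean hX hY hX' hY') (fun _ => geomMean_nonneg)
    (fun t => geomMean_le_arithMean (hX' t).nonneg (hY' t)) (integrable_arithMean hXi hYi)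

/-- The integral of the geometric means is at most the geometric mean of the integrals. -/
lemma integral_geomMean_le (hX : Continuous X) (hY : Continuous Y)
    (hX' : ∀ t, IsStrictlyPositive (X t)) (hY' : ∀ t, IsStrictlyPositive (Y t))
    (hXi : Integrable X μ) (hYi : Integrable Y μ) :
    ∫ t, geomMean (X t) (Y t) ∂μ ≤ geomMean (∫ t, X t ∂μ) (∫ t, Y t ∂μ) := by
  -- For `μ = 0` the integral of `Y` is `0`, in general not invertible, so the extremal
  -- characterisation does not apply.
  rcases eq_or_ne μ 0 with rfl | hμ
  · simpa using geomMean_nonneg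
  have hZi := integrable_geomMean hX hY hX' hY' hXi hYi
  refine BlockNonneg.le_geomMean (isStrictlyPositive_integral hμ hY hY' hYi)
    (.of_nonneg (integral_nonneg fun t => geomMean_nonneg)) fun W => ?_
  -- For fixed `W` the test expression is linear in the matrix entries. Writing its multiplications
  -- as continuous linear maps lets them pass through the Bochner integral.
  let l : (H →L[ℂ] H) →L[ℂ] (H →L[ℂ] H) := ContinuousLinearMap.mul ℂ _ (star W)
  let r : (H →L[ℂ] H) →L[ℂ] (H →L[ℂ] H) := (ContinuousLinearMap.mul ℂ _).flip W
  have hsum : (∫ t, X t ∂μ) + star W * (∫ t, geomMean (X t) (Y t) ∂μ) +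
      (∫ t, geomMean (X t) (Y t) ∂μ) * W + star W * (∫ t, Y t ∂μ) * W =
      ∫ t, (X t + l (geomMean (X t) (Y t)) + r (geomMean (X t) (Y t)) + r (l (Y t))) ∂μ := by
    have i1 := l.integrable_comp hZi
    have i2 := r.integrable_comp hZi
    have i3 := (r.comp l).integrable_comp hYi
    have e3 := (r.comp l).integral_comp_comm hYi
    simp only [ContinuousLinearMap.comp_apply] at i3 e3
    have i4 : Integrable (fun t => X t + l (geomMean (X t) (Y t))) μ := hXi.add i1
    have i5 : Integrable
        (fun t => X t + l (geomMean (X t) (Y t)) + r (geomMean (X t) (Y t))) μ := i4.add i2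
    rw [integral_add i5 i3, integral_add i4 i2, integral_add hXi i1, l.integral_comp_comm hZi, r.integral_comp_comm hZi, e3]
    rfl
  rw [hsum]
  exact integral_nonneg fun t => blockNonneg_geomMean (hX' t).nonneg (hY' t) W

/-- If a field `P` lies between `0` and `X ♯ Y` pointwise, then its integral exists and lies below
`(∫ X) ♯ (∫ Y)`. -/
lemma integrable_and_integral_le_geomMean {P : T → (H →L[ℂ] H)} (hP : Continuous P)
    (hP0 : ∀ t, 0 ≤ P t) (hX : Continuous X) (hY : Continuous Y)
    (hX' : ∀ t, IsStrictlyPositive (X t)) (hY' : ∀ t, IsStrictlyPositive (Y t))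
    (hXi : Integrable X μ) (hYi : Integrable Y μ) (hle : ∀ t, P t ≤ geomMean (X t) (Y t)) :
    Integrable P μ ∧ ∫ t, P t ∂μ ≤ geomMean (∫ t, X t ∂μ) (∫ t, Y t ∂μ) := by
  have hZi := integrable_geomMean hX hY hX' hY' hXi hYi
  have hPi := integrable_of_nonneg_of_le hP hP0 hle hZi
  exact ⟨hPi, (integral_mono hPi hZi hle).trans (integral_geomMean_le hX hY hX' hY' hXi hYi)⟩

end Fields

/-! ### The equivalences. -/

section Equivalence

variable {f : ℝ → ℝ}

lemma OperatorLogConvex.divergenceMeanInequality (hf : ContinuousOn f (Set.Ioi 0))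
    (hpos : ∀ x, 0 < x → 0 < f x) (hlog : OperatorLogConvex.{u} f) :
    DivergenceMeanInequality.{u, v} f := by
  intro H _ _ _ 𝔄 _ T _ _ _ _ _ μ _ _ A B C D hA hB hC hD iAB iAD iCB iCD
  have cts : ∀ {A B : T → (H →L[ℂ] H)}, IsPosField 𝔄 A → IsPosField 𝔄 B →
      Continuous fun t => perspective f (A t) (B t) := fun hA hB =>
    continuous_perspective hf hA.continuous hB.continuous hA.strictlyPositive hB.strictlyPositive
  have pos : ∀ {A B : T → (H →L[ℂ] H)}, IsPosField 𝔄 A → IsPosField 𝔄 B →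
      ∀ t, IsStrictlyPositive (perspective f (A t) (B t)) := fun hA hB t =>
    isStrictlyPositive_perspective hf hpos (hA.strictlyPositive t) (hB.strictlyPositive t)
  have posAC t := isStrictlyPositive_arithMean (hA.strictlyPositive t) (hC.strictlyPositive t)
  have posBD t := isStrictlyPositive_arithMean (hB.strictlyPositive t) (hD.strictlyPositive t)
  have h := integrable_and_integral_le_geomMean
    (continuous_perspective hf (continuous_arithMean hA.continuous hC.continuous)
      (continuous_arithMean hB.continuous hD.continuous) posAC posBD)
    (fun t => (isStrictlyPositive_perspective hf hpos (posAC t) (posBD t)).nonneg)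
    (continuous_arithMean (cts hA hB) (cts hA hD)) (continuous_arithMean (cts hC hB) (cts hC hD))
    (fun t => isStrictlyPositive_arithMean (pos hA hB t) (pos hA hD t))
    (fun t => isStrictlyPositive_arithMean (pos hC hB t) (pos hC hD t))
    (integrable_arithMean iAB iAD) (integrable_arithMean iCB iCD)
    (fun t => perspective_arithMean_arithMean_le hf hpos hlog (hA.strictlyPositive t)
      (hB.strictlyPositive t) (hC.strictlyPositive t) (hD.strictlyPositive t))
  rwa [integral_arithMean iAB iAD, integral_arithMean iCB iCD] at h

lemma OperatorLogConvex.divergenceLogConvexFirst (hf : ContinuousOn f (Set.Ioi 0))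
    (hpos : ∀ x, 0 < x → 0 < f x) (hlog : OperatorLogConvex.{u} f) :
    DivergenceLogConvexFirst.{u, v} f := by
  intro H _ _ _ 𝔄 _ T _ _ _ _ _ μ _ _ A B C hA hB hC iAB iCB
  have posAC t := isStrictlyPositive_arithMean (hA.strictlyPositive t) (hC.strictlyPositive t)
  exact integrable_and_integral_le_geomMean
    (continuous_perspective hf (continuous_arithMean hA.continuous hC.continuous) hB.continuous
      posAC hB.strictlyPositive)
    (fun t => (isStrictlyPositive_perspective hf hpos (posAC t) (hB.strictlyPositive t)).nonneg)
    (continuous_perspective hf hA.continuous hB.continuous hA.strictlyPositive hB.strictlyPositive)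
    (continuous_perspective hf hC.continuous hB.continuous hC.strictlyPositive hB.strictlyPositive)
    (fun t => isStrictlyPositive_perspective hf hpos (hA.strictlyPositive t)
      (hB.strictlyPositive t))
    (fun t => isStrictlyPositive_perspective hf hpos (hC.strictlyPositive t)
      (hB.strictlyPositive t)) iAB iCB
    (fun t => perspective_arithMean_left_le hf hpos hlog (hA.strictlyPositive t)
      (hC.strictlyPositive t) (hB.strictlyPositive t))

lemma OperatorLogConvex.divergenceConvexSecond (hf : ContinuousOn f (Set.Ioi 0))
    (hpos : ∀ x, 0 < x → 0 < f x) (hlog : OperatorLogConvex.{u} f) :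
    DivergenceConvexSecond.{u, v} f := by
  intro H _ _ _ 𝔄 _ T _ _ _ _ _ μ _ _ A B D hA hB hD iAB iAD r hr hr'
  have posE t := isStrictlyPositive_convexCombination hr hr' (hB.strictlyPositive t)
    (hD.strictlyPositive t)
  have hle t := perspective_convexCombination_right_le hf hpos hlog (hA.strictlyPositive t)
    (hB.strictlyPositive t) (hD.strictlyPositive t) hr hr'
  have iB : Integrable (fun t => r • perspective f (A t) (B t)) μ := iAB.smul r
  have iD : Integrable (fun t => (1 - r) • perspective f (A t) (D t)) μ := iAD.smul (1 - r)
  have hQ : Integrable (fun t => r • perspective f (A t) (B t) +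
      (1 - r) • perspective f (A t) (D t)) μ := iB.add iD
  have hP : DivergenceExists f μ A (fun t => r • B t + (1 - r) • D t) :=
    integrable_of_nonneg_of_le
      (continuous_perspective hf hA.continuous
        ((hB.continuous.const_smul r).add (hD.continuous.const_smul (1 - r)))
        hA.strictlyPositive posE)
      (fun t => (isStrictlyPositive_perspective hf hpos (hA.strictlyPositive t) (posE t)).nonneg)
      hle hQ
  refine ⟨hP, (integral_mono hP hQ hle).trans_eq ?_⟩
  rw [integral_add iB iD, integral_smul, integral_smul]
  rfl

section OnePoint

variable {H : Type u} [NormedAddCommGroup H] [InnerProductSpace ℂ H] [CompleteSpace H]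

lemma isPosField_const {T : Type v} [TopologicalSpace T] {A : H →L[ℂ] H}
    (hA : IsStrictlyPositive A) : IsPosField ⊤ (fun _ : T => A) :=
  ⟨continuous_const, fun _ => trivial, fun _ => hA⟩

/-- A unit atom with second argument `1` recovers the functional calculus of `f`, which is what the
converse implications need. -/
lemma divergence_dirac_one_right (f : ℝ → ℝ) (A : H →L[ℂ] H) :
    divergence f (Measure.dirac PUnit.unit.{v + 1}) (fun _ => A) (fun _ => 1) = cfc f A := by
  simp [divergence, perspective_one_right]

lemma divergenceExists_const {T : Type v} [MeasurableSpace T] (f : ℝ → ℝ) (μ : Measure T)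
    [IsFiniteMeasure μ] (A B : H →L[ℂ] H) :
    DivergenceExists f μ (fun _ => A) (fun _ => B) := integrable_const _

end OnePoint

lemma DivergenceMeanInequality.operatorLogConvex (h : DivergenceMeanInequality.{u, v} f) :
    OperatorLogConvex.{u} f := by
  intro H _ _ _ A C hA hC
  have := (h H ⊤ isClosed_univ PUnit.{v + 1} (Measure.dirac PUnit.unit) (fun _ => A) (fun _ => 1)
    (fun _ => C) (fun _ => 1) (isPosField_const hA) (isPosField_const isStrictlyPositive_one)
    (isPosField_const hC) (isPosField_const isStrictlyPositive_one)
    (divergenceExists_const ..) (divergenceExists_const ..) (divergenceExists_const ..)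
    (divergenceExists_const ..)).2
  -- With `B = D = 1` the means in the second variable, and those of equal divergences, collapse.
  simpa only [arithMean_self, divergence_dirac_one_right] using this

lemma DivergenceLogConvexFirst.operatorLogConvex (h : DivergenceLogConvexFirst.{u, v} f) :
    OperatorLogConvex.{u} f := by
  intro H _ _ _ A C hA hC
  have := (h H ⊤ isClosed_univ PUnit.{v + 1} (Measure.dirac PUnit.unit) (fun _ => A) (fun _ => 1)
    (fun _ => C) (isPosField_const hA) (isPosField_const isStrictlyPositive_one)
    (isPosField_const hC) (divergenceExists_const ..) (divergenceExists_const ..)).2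
  simpa only [divergence_dirac_one_right] using this

end Equivalence

end FDiv

end

theorem theorem3p2 (f : ℝ → ℝ) (hf : ContinuousOn f (Set.Ioi 0))
    (hpos : ∀ x, 0 < x → 0 < f x) :
    (FDiv.OperatorLogConvex.{u} f ↔ FDiv.DivergenceMeanInequality.{u, v} f) ∧
    (FDiv.OperatorLogConvex.{u} f ↔
      FDiv.DivergenceLogConvexFirst.{u, v} f ∧ FDiv.DivergenceConvexSecond.{u, v} f) :=
  ⟨⟨fun h => h.divergenceMeanInequality hf hpos, fun h => h.operatorLogConvex⟩,
    ⟨fun h => ⟨h.divergenceLogConvexFirst hf hpos, h.divergenceConvexSecond hf hpos⟩,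
      fun h => h.1.operatorLogConvex⟩⟩
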